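/- \textbf{Setting.} An instance of \emph{stochastic submodular cover with independent items} consists of a finite groundset $U$; a monotone submodular function $f:2^U\to\mathbb{Z}_{\ge 0}$ with $Q:=f(U)$; and finitely many items, where item $i$ has a cost $c_i\in\mathbb{R}_{\ge 0}$ and realizes to a random element $X_i\in U$ with a given distribution. The $X_i$ are independent, and the realizations of all the items together cover $f$ with probability one. Here a set $S$ of items \emph{covers} $f$ if $f(\{X_i : i\in S\})=Q$; its cost is $c(S)=\sum_{i\in S}c_i$. A \emph{fully adaptive solution} probes items one at a time; whether it stops, and otherwise which item it probes next, may depend on all realizations observed so far. Let $\mathrm{OPT}$ be the infimum of the expected total cost of the probed items over all fully adaptive solutions that cover $f$ with probability one. An \emph{$r$-round set-based solution} selects in each round $k=1,\dots,r$ a set $S_k$ of items, depending only on the realizations observed in rounds $1,\dots,k-1$; all items of $S_k$ are probed in parallel, and the round incurs the cost $c(S_k)$. \textbf{Corollary (independent items, set-based model).} For every constant $\kappa>0$ there is a constant $C>0$, depending only on $\kappa$, such that every instance has, for some $r\le C\log(Q+1)$, an $r$-round set-based solution whose expected total cost is at most $C\log(Q+1)\cdot\mathrm{OPT}$ and which covers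 $f$ with probability at least $1-(Q+1)^{-\kappa}$. In particular, for $Q\ge 2$ there are $O(\log Q)$ rounds, the expected cost is $O(\log Q)\cdot\mathrm{OPT}$, and $f$ is covered with probability at least $1-Q^{-\kappa}$. -/

import Mathlib

namespace StochSubmodCover

/-- An instance of stochastic submodular cover with independent items. The items are indexed by the
finite type `ι`, the groundset is the finite type `U`, and `f : 2^U → ℤ₊` is monotone and
submodular. Item `i` has cost `cost i` and realizes to a random element of `U` with law `law i`,
independently of the other items. Probing all the items covers `f` with probability one. -/
structure SSCInstance (ι U : Type*) [Fintype ι] [Fintype U] [DecidableEq U] where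
  f : Finset U → ℕ
  monotone_f : Monotone f
  submodular_f : ∀ A B : Finset U, f (A ∪ B) + f (A ∩ B) ≤ f A + f B
  cost : ι → ℝ
  cost_nonneg : ∀ i, 0 ≤ cost i
  law : ι → PMF U
  feasible : ∀ ω : ι → U, (∀ i, ω i ∈ (law i).support) →
    f (Finset.univ.image ω) = f Finset.univ

/-- A (fully) adaptive solution, as a decision tree: either halt, or probe item `i` and continue in
a way that depends on its realization. -/
inductive AdaptiveSolution (ι U : Type*) : Type _
  | halt : AdaptiveSolution ι U
  | probe (i : ι) (next : U → AdaptiveSolution ι U) : AdaptiveSolution ι U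

/-- An `r`-round adaptive solution in the set-based model: in each round a set `S` of items is
probed in parallel, and the remaining rounds depend on the realizations of the items in `S`. -/
inductive SetSolution (ι U : Type*) : ℕ → Type _
  | done : SetSolution ι U 0
  | round {r : ℕ} (S : Finset ι) (next : (S → U) → SetSolution ι U r) : SetSolution ι U (r + 1)

section

variable {ι U : Type*} [DecidableEq ι]

/-- The items probed by an adaptive solution when item `i` realizes to `ω i`. -/
def AdaptiveSolution.probed : AdaptiveSolution ι U → (ι → U) → Finset ι
  | .halt, _ => ∅
  | .probe i next, ω => insert i ((next (ω i)).probed ω)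

/-- The items probed by a set-based solution when item `i` realizes to `ω i`. -/
def SetSolution.probed : {r : ℕ} → SetSolution ι U r → (ι → U) → Finset ι
  | _, .done, _ => ∅
  | _, .round S next, ω => S ∪ (next fun i => ω i).probed ω

end

namespace SSCInstance

variable {ι U : Type*} [Fintype ι] [DecidableEq ι] [Fintype U] [DecidableEq U]

/-- The maximal value `Q = f(U)`. -/
def Q (I : SSCInstance ι U) : ℕ := I.f Finset.univ

/-- The probability that every item `i` realizes to `ω i` (the items are independent). -/
noncomputable def prob (I : SSCInstance ι U) (ω : ι → U) : ℝ :=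
  ∏ i, (I.law i (ω i)).toReal

/-- Expectation over the realizations of the items. -/
noncomputable def expect (I : SSCInstance ι U) (g : (ι → U) → ℝ) : ℝ :=
  ∑ ω, I.prob ω * g ω

/-- The total cost `c(S)` of a set of items. -/
def setCost (I : SSCInstance ι U) (S : Finset ι) : ℝ := ∑ i ∈ S, I.cost i

/-- The set `S` of items covers `f` under the realization `ω`: `f({ω i : i ∈ S}) = Q`. -/
def Covers (I : SSCInstance ι U) (S : Finset ι) (ω : ι → U) : Prop :=
  I.f (S.image ω) = I.Q

instance (I : SSCInstance ι U) (S : Finset ι) (ω : ι → U) : Decidable (I.Covers S ω) :=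
  inferInstanceAs (Decidable (_ = _))

/-- The expected total cost of the items probed by an adaptive solution. -/
noncomputable def adaptiveCost (I : SSCInstance ι U) (A : AdaptiveSolution ι U) : ℝ :=
  I.expect fun ω => I.setCost (A.probed ω)

/-- The adaptive solution covers `f` with probability one. -/
def AlwaysCovers (I : SSCInstance ι U) (A : AdaptiveSolution ι U) : Prop :=
  ∀ ω, (∀ i, ω i ∈ (I.law i).support) → I.Covers (A.probed ω) ω

/-- The optimal expected cost of a fully adaptive solution that always covers `f`. -/
noncomputable def opt (I : SSCInstance ι U) : ℝ :=
  sInf {c | ∃ A : AdaptiveSolution ι U, I.AlwaysCovers A ∧ I.adaptiveCost A = c}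

/-- The cost incurred by a set-based solution under the realization `ω`: each round incurs the
total cost of the set of items that it probes. -/
def pathCost (I : SSCInstance ι U) : {r : ℕ} → SetSolution ι U r → (ι → U) → ℝ
  | _, .done, _ => 0
  | _, .round S next, ω => I.setCost S + I.pathCost (next fun i => ω i) ω

/-- The expected cost of a set-based solution. -/
noncomputable def setBasedCost (I : SSCInstance ι U) {r : ℕ} (B : SetSolution ι U r) : ℝ :=
  I.expect fun ω => I.pathCost B ω

/-- The probability that a set-based solution covers `f`. -/
noncomputable def coverProb (I : SSCInstance ι U) {r : ℕ} (B : SetSolution ι U r) : ℝ :=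
  I.expect fun ω => if I.Covers (B.probed ω) ω then 1 else 0

/-- The infimum in `opt` is over a nonempty set that is bounded below. -/
theorem opt_set_nonempty_bddBelow (I : SSCInstance ι U) :
    {c | ∃ A : AdaptiveSolution ι U, I.AlwaysCovers A ∧ I.adaptiveCost A = c}.Nonempty ∧
    BddBelow {c | ∃ A : AdaptiveSolution ι U, I.AlwaysCovers A ∧ I.adaptiveCost A = c} := by
  constructor
  · let P : List ι → AdaptiveSolution ι U :=
      fun l => l.foldr (fun i A => .probe i fun _ => A) .halt
    have hP : ∀ (l : List ι) (ω : ι → U), (P l).probed ω = l.toFinset := by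
      intro l ω
      induction l with
      | nil => rfl
      | cons i l ih => rw [List.toFinset_cons, ← ih]; rfl
    refine ⟨_, P Finset.univ.toList, fun ω hω => ?_, rfl⟩
    rw [hP, Finset.toList_toFinset]
    exact I.feasible ω hω
  · refine ⟨0, ?_⟩
    rintro _ ⟨A, -, rfl⟩
    exact Finset.sum_nonneg fun ω _ => mul_nonneg
      (Finset.prod_nonneg fun i _ => ENNReal.toReal_nonneg)
      (Finset.sum_nonneg fun i _ => I.cost_nonneg i)

end SSCInstance

end StochSubmodCover

/-! An optimal adaptive solution `A` can be replayed non-adaptively. Draw one realization to select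
the root-leaf path of `A`, and probe that set of items under an independent second realization. By
submodularity this keeps, in expectation, at least half of the gain of `A` over any base set
(`adaptive_le_two_mul_decoupled`). Averaging gives a fixed set whose cost is at most thrice that of
`A` and whose expected residual value is at most 3/4 of the old one (`exists_set_quarter`).

After a round the items are still independent, the probed ones now deterministic, and the same `A`
still covers. So the step can be repeated, and by the tower property each round costs at most 3 OPT
in expectation (`exists_setSolution`). The residual is an integer, so the failure probability after
`r` rounds is at most its mean, hence at most (3/4)^r Q; a logarithmic `r` suffices. -/

namespace StochSubmodCover

/-! ### Expectations under product laws -/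

variable {ι U : Type*} [Fintype ι] [DecidableEq ι] [Fintype U]

/-- Expectation when the items are independent and item `i` has law `w i`. -/
noncomputable def lawExpect (w : ι → PMF U) (g : (ι → U) → ℝ) : ℝ :=
  ∑ ω, (∏ i, (w i (ω i)).toReal) * g ω

theorem sum_toReal_pmf (p : PMF U) : ∑ u, (p u).toReal = 1 := by
  have h := p.tsum_coe
  rw [tsum_fintype] at h
  rw [← ENNReal.toReal_sum fun u _ => p.apply_ne_top u, h, ENNReal.toReal_one]

omit [DecidableEq ι] [Fintype U] in
theorem prod_toReal_eq_zero {w : ι → PMF U} {ω : ι → U} (h : ¬∀ i, ω i ∈ (w i).support) :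
    ∏ i, (w i (ω i)).toReal = 0 := by
  push Not at h
  obtain ⟨i, hi⟩ := h
  refine Finset.prod_eq_zero (Finset.mem_univ i) ?_
  rw [(w i).apply_eq_zero_iff _ |>.2 hi, ENNReal.toReal_zero]

theorem lawExpect_mono {w : ι → PMF U} {g h : (ι → U) → ℝ}
    (H : ∀ ω, (∀ i, ω i ∈ (w i).support) → g ω ≤ h ω) : lawExpect w g ≤ lawExpect w h := by
  refine Finset.sum_le_sum fun ω _ => ?_
  by_cases hω : ∀ i, ω i ∈ (w i).support
  · exact mul_le_mul_of_nonneg_left (H ω hω) (Finset.prod_nonneg fun i _ => ENNReal.toReal_nonneg)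
  · simp [prod_toReal_eq_zero hω]

theorem lawExpect_congr {w : ι → PMF U} {g h : (ι → U) → ℝ}
    (H : ∀ ω, (∀ i, ω i ∈ (w i).support) → g ω = h ω) : lawExpect w g = lawExpect w h :=
  le_antisymm (lawExpect_mono fun ω hω => (H ω hω).le) (lawExpect_mono fun ω hω => (H ω hω).ge)

theorem lawExpect_const (w : ι → PMF U) (c : ℝ) : lawExpect w (fun _ => c) = c := by
  have h : ∑ ω : ι → U, ∏ i, (w i (ω i)).toReal = 1 := by
    have := Finset.prod_univ_sum (fun _ : ι => (Finset.univ : Finset U))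
      (fun i u => (w i u).toReal)
    rw [Fintype.piFinset_univ] at this
    rw [← this]
    simp [sum_toReal_pmf]
  rw [lawExpect, ← Finset.sum_mul, h, one_mul]

theorem lawExpect_add (w : ι → PMF U) (g h : (ι → U) → ℝ) :
    lawExpect w (fun ω => g ω + h ω) = lawExpect w g + lawExpect w h := by
  simp [lawExpect, mul_add, Finset.sum_add_distrib]

theorem lawExpect_const_mul (w : ι → PMF U) (c : ℝ) (g : (ι → U) → ℝ) :
    lawExpect w (fun ω => c * g ω) = c * lawExpect w g := by
  simp only [lawExpect, Finset.mul_sum]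
  exact Finset.sum_congr rfl fun _ _ => by ring

theorem lawExpect_sub (w : ι → PMF U) (g h : (ι → U) → ℝ) :
    lawExpect w (fun ω => g ω - h ω) = lawExpect w g - lawExpect w h := by
  simp [lawExpect, mul_sub, Finset.sum_sub_distrib]

theorem exists_le_of_le_lawExpect {w : ι → PMF U} {g : (ι → U) → ℝ} {c : ℝ}
    (h : c ≤ lawExpect w g) : ∃ ω, (∀ i, ω i ∈ (w i).support) ∧ c ≤ g ω := by
  by_contra! H
  obtain ⟨ω₀, hω₀⟩ : ∃ ω₀ : ι → U, ∀ i, ω₀ i ∈ (w i).support :=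
    ⟨fun i => (w i).support_nonempty.some, fun i => (w i).support_nonempty.some_mem⟩
  refine absurd h (not_le.2 ?_)
  rw [← lawExpect_const w c]
  refine Finset.sum_lt_sum (fun ω _ => ?_) ⟨ω₀, Finset.mem_univ _, ?_⟩
  · by_cases hω : ∀ i, ω i ∈ (w i).support
    · exact mul_le_mul_of_nonneg_left (H ω hω).le
        (Finset.prod_nonneg fun i _ => ENNReal.toReal_nonneg)
    · simp [prod_toReal_eq_zero hω]
  · refine mul_lt_mul_of_pos_left (H ω₀ hω₀) (Finset.prod_pos fun i _ => ?_)
    exact ENNReal.toReal_pos (((w i).mem_support_iff _).1 (hω₀ i)) ((w i).apply_ne_top _)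

/-- The conditional laws of the items once the items in `S` have realized to `τ`. -/
noncomputable def condLaw (w : ι → PMF U) (S : Finset ι) (τ : ι → U) (i : ι) : PMF U :=
  if i ∈ S then PMF.pure (τ i) else w i

/-- Tower property: conditioning a product law on some coordinates gives a product law again. -/
theorem lawExpect_condLaw (w : ι → PMF U) (S : Finset ι) (g : (ι → U) → ℝ) :
    lawExpect w (fun τ => lawExpect (condLaw w S τ) g) = lawExpect w g := by
  have key : ∀ ω : ι → U, ∑ τ : ι → U, (∏ i, (w i (τ i)).toReal) *
      ∏ i, (condLaw w S τ i (ω i)).toReal = ∏ i, (w i (ω i)).toReal := by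
    intro ω
    -- The sum over `τ` factors over the items: for `i ∈ S` only `τ i = ω i` survives, and otherwise
    -- `τ i` sums out to one.
    have := Finset.prod_univ_sum (fun _ : ι => (Finset.univ : Finset U))
      (fun i u => (w i u).toReal * ((if i ∈ S then PMF.pure u else w i) (ω i)).toReal)
    rw [Fintype.piFinset_univ] at this
    simp only [← Finset.prod_mul_distrib, condLaw]
    rw [← this]
    refine Finset.prod_congr rfl fun i _ => ?_
    by_cases hi : i ∈ S
    · simp only [hi, if_true, PMF.pure_apply]
      rw [Finset.sum_eq_single (ω i)]
      · simp
      · intro u _ hu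
        simp [hu.symm]
      · simp
    · simp only [hi, if_false]
      rw [← Finset.sum_mul, sum_toReal_pmf, one_mul]
  simp only [lawExpect, Finset.mul_sum]
  rw [Finset.sum_comm]
  refine Finset.sum_congr rfl fun ω _ => ?_
  rw [← key, Finset.sum_mul]
  exact Finset.sum_congr rfl fun τ _ => by ring

theorem lawExpect_apply (w : ι → PMF U) (i : ι) (h : U → ℝ) :
    lawExpect w (fun ω => h (ω i)) = ∑ u, (w i u).toReal * h u := by
  have := Finset.prod_univ_sum (fun _ : ι => (Finset.univ : Finset U))
    (fun j u => (w j u).toReal * if j = i then h u else 1)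
  rw [Fintype.piFinset_univ] at this
  simp only [Finset.prod_mul_distrib, Finset.prod_ite_eq', Finset.mem_univ, if_true] at this
  rw [lawExpect, ← this, Finset.prod_eq_single i]
  · simp
  · intro j _ hj
    simp [hj, sum_toReal_pmf]
  · simp

theorem lawExpect_update (w : ι → PMF U) (i : ι) (g : (ι → U) → ℝ) :
    lawExpect w g =
      ∑ u, (w i u).toReal * lawExpect (Function.update w i (PMF.pure u)) g := by
  rw [← lawExpect_condLaw w {i} g,
    ← lawExpect_apply w i fun u => lawExpect (Function.update w i (PMF.pure u)) g]
  refine lawExpect_congr fun τ _ => ?_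
  congr 1
  funext j
  by_cases hj : j = i
  · subst hj
    simp [condLaw]
  · simp [condLaw, hj]

theorem lawExpect_update_congr {w : ι → PMF U} {i : ι} {u : U} {g h : (ι → U) → ℝ}
    (H : ∀ ω, ω i = u → g ω = h ω) :
    lawExpect (Function.update w i (PMF.pure u)) g =
      lawExpect (Function.update w i (PMF.pure u)) h :=
  lawExpect_congr fun ω hω => H ω <| by simpa using hω i

/-! ### Decoupling the path from the realizations -/

variable [DecidableEq U]

/-- Decoupling: drawing the items on a root-leaf path of `A` and their realizations independently
retains at least half of the expected gain of `A` over the base set `D`. The set `P` contains the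
items that are ignored, and the two laws have to agree on the other items. -/
theorem adaptive_le_two_mul_decoupled {g : Finset U → ℝ} (hmono : Monotone g)
    (hsub : ∀ X Y, g (X ∪ Y) + g (X ∩ Y) ≤ g X + g Y) (A : AdaptiveSolution ι U) :
    ∀ (P : Finset ι) (w w' : ι → PMF U) (D : Finset U), (∀ i, i ∉ P → w i = w' i) →
      lawExpect w' (fun ω' => g (D ∪ (A.probed ω' \ P).image ω')) + g D ≤
        2 * lawExpect w' (fun ω' => lawExpect w fun ω => g (D ∪ (A.probed ω' \ P).image ω)) := by
  induction A with
  | halt =>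
    intro P w w' D _
    simp only [AdaptiveSolution.probed, Finset.empty_sdiff, Finset.image_empty, Finset.union_empty,
      lawExpect_const]
    linarith
  | probe i next ih =>
    intro P w w' D hP
    have hone := sum_toReal_pmf (w' i)
    set p : U → ℝ := fun u => (w' i u).toReal with hp
    have hp0 : ∀ u, 0 ≤ p u := fun u => ENNReal.toReal_nonneg
    -- A repeated probe adds no item; it only steers the tree, so only `w'` is conditioned.
    by_cases hi : i ∈ P
    · have hX : ∀ X : Finset ι, insert i X \ P = X \ P := fun X =>
        Finset.insert_sdiff_of_mem X hi
      rw [lawExpect_update w' i, lawExpect_update w' i (fun ω' => lawExpect w _)]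
      have h1 : g D = ∑ u, p u * g D := by rw [← Finset.sum_mul, hone, one_mul]
      rw [h1, ← Finset.sum_add_distrib, Finset.mul_sum]
      refine Finset.sum_le_sum fun u _ => ?_
      have := ih u P w (Function.update w' i (PMF.pure u)) D fun j hj => by
        rw [Function.update_of_ne (by rintro rfl; exact hj hi), hP j hj]
      have hu : ∀ ω' : ι → U, ω' i = u →
          (AdaptiveSolution.probe i next).probed ω' \ P = (next u).probed ω' \ P := fun ω' h => by
        rw [AdaptiveSolution.probed, hX, h]
      rw [← lawExpect_update_congr (g := fun ω' =>
            g (D ∪ ((AdaptiveSolution.probe i next).probed ω' \ P).image ω'))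
          (h := fun ω' => g (D ∪ ((next u).probed ω' \ P).image ω')) fun ω' h => by rw [hu ω' h],
        ← lawExpect_update_congr (g := fun ω' => lawExpect w fun ω =>
            g (D ∪ ((AdaptiveSolution.probe i next).probed ω' \ P).image ω))
          (h := fun ω' => lawExpect w fun ω => g (D ∪ ((next u).probed ω' \ P).image ω)) fun ω' h => by simp only [hu ω' h]] at this
      rw [← mul_add, mul_left_comm]
      exact mul_le_mul_of_nonneg_left this (hp0 u)
    · have hX : ∀ X : Finset ι, insert i X \ P = insert i (X \ insert i P) := by
        intro X
        ext j
        by_cases hj : j = i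
        · simp [hj, hi]
        · simp [hj]
      -- Here `u` is the outcome that steers the tree and `v` its independent copy, which enters the
      -- decoupled value.
      let a : U → ℝ := fun u => lawExpect (Function.update w' i (PMF.pure u)) fun ω' =>
        g (D ∪ insert u (((next u).probed ω' \ insert i P).image ω'))
      let b : U → U → ℝ := fun u v => lawExpect (Function.update w' i (PMF.pure u)) fun ω' =>
        lawExpect (Function.update w i (PMF.pure v)) fun ω =>
          g (D ∪ insert v (((next u).probed ω' \ insert i P).image ω))
      have hL : lawExpect w' (fun ω' =>
          g (D ∪ (((AdaptiveSolution.probe i next).probed ω') \ P).image ω')) = ∑ u, p u * a u := by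
        rw [lawExpect_update w' i]
        refine Finset.sum_congr rfl fun u _ => ?_
        congr 1
        refine lawExpect_update_congr fun ω' h => ?_
        simp only [AdaptiveSolution.probed, hX, h, Finset.image_insert]
      have hR : lawExpect w' (fun ω' => lawExpect w fun ω =>
          g (D ∪ (((AdaptiveSolution.probe i next).probed ω') \ P).image ω)) =
            ∑ u, p u * ∑ v, p v * b u v := by
        rw [lawExpect_update w' i]
        refine Finset.sum_congr rfl fun u _ => ?_
        congr 1
        have : ∑ v, p v * b u v = lawExpect (Function.update w' i (PMF.pure u)) fun ω' =>
            ∑ v, p v * lawExpect (Function.update w i (PMF.pure v)) fun ω =>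
              g (D ∪ insert v (((next u).probed ω' \ insert i P).image ω)) := by
          simp only [b, lawExpect, Finset.mul_sum]
          rw [Finset.sum_comm]
          refine Finset.sum_congr rfl fun _ _ => Finset.sum_congr rfl fun _ _ =>
            Finset.sum_congr rfl fun _ _ => ?_
          ring
        rw [this]
        refine lawExpect_update_congr fun ω' h => ?_
        rw [lawExpect_update w i, hP i hi]
        refine Finset.sum_congr rfl fun v _ => ?_
        congr 1
        refine lawExpect_update_congr fun ω h' => ?_
        simp only [AdaptiveSolution.probed, hX, h, h', Finset.image_insert]
      -- Submodularity bounds the loss from replacing `u` by `v` by the marginal value of `u` over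
      -- `D`. The induction hypothesis is then used over the base `insert v D`.
      have hab : ∀ u v, a u + g D ≤ g (insert u D) - g (insert v D) + 2 * b u v := by
        intro u v
        have h1 := ih u (insert i P) (Function.update w i (PMF.pure v))
          (Function.update w' i (PMF.pure u)) (insert v D) fun j hj => by
            rw [Finset.mem_insert, not_or] at hj
            rw [Function.update_of_ne hj.1, Function.update_of_ne hj.1, hP j hj.2]
        have h2 : ∀ Z : Finset U, insert v D ∪ Z = D ∪ insert v Z := fun Z => by
          rw [Finset.insert_union, Finset.union_insert]
        simp only [h2] at h1
        have h3 : a u ≤ lawExpect (Function.update w' i (PMF.pure u)) (fun ω' =>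
            g (D ∪ insert v (((next u).probed ω' \ insert i P).image ω')) +
              (g (insert u D) - g D)) := by
          refine lawExpect_mono fun ω' _ => ?_
          generalize ((next u).probed ω' \ insert i P).image ω' = Z
          have h4 := hsub (D ∪ insert v Z) (insert u D)
          have h5 : g (D ∪ insert u Z) ≤ g (D ∪ insert v Z ∪ insert u D) := by
            refine hmono fun x => ?_
            simp only [Finset.mem_union, Finset.mem_insert]
            tauto
          have h6 : g D ≤ g ((D ∪ insert v Z) ∩ insert u D) := by
            refine hmono fun x => ?_
            simp only [Finset.mem_union, Finset.mem_insert, Finset.mem_inter]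
            tauto
          linarith
        rw [lawExpect_add, lawExpect_const] at h3
        change _ ≤ 2 * b u v at h1
        linarith
      rw [hL, hR]
      have e1 : ∀ x : ℝ, x = ∑ v, p v * x := fun x => by rw [← Finset.sum_mul, hone, one_mul]
      -- Averaged over `u` and `v`, which have the same law, the two singleton terms cancel.
      have h1 : ∑ u, p u * ∑ v, p v * (a u + g D) ≤
          ∑ u, p u * ∑ v, p v * (g (insert u D) - g (insert v D) + 2 * b u v) :=
        Finset.sum_le_sum fun u _ => mul_le_mul_of_nonneg_left
          (Finset.sum_le_sum fun v _ => mul_le_mul_of_nonneg_left (hab u v) (hp0 v)) (hp0 u)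
      have h2 : ∀ u, ∑ v, p v * (g (insert u D) - g (insert v D) + 2 * b u v) =
          g (insert u D) - ∑ v, p v * g (insert v D) + 2 * ∑ v, p v * b u v := by
        intro u
        conv_rhs => rw [e1 (g (insert u D))]
        rw [Finset.mul_sum, ← Finset.sum_sub_distrib, ← Finset.sum_add_distrib]
        exact Finset.sum_congr rfl fun v _ => by ring
      simp only [h2, ← e1] at h1
      simp only [mul_add, mul_sub, Finset.sum_add_distrib, Finset.sum_sub_distrib, ← e1] at h1
      rw [Finset.mul_sum]
      have h3 : ∑ u, p u * (2 * ∑ v, p v * b u v) = ∑ u, 2 * (p u * ∑ v, p v * b u v) :=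
        Finset.sum_congr rfl fun u _ => by ring
      linarith

/-! ### From one round to many -/

namespace SSCInstance

variable (I : SSCInstance ι U)

omit [DecidableEq ι] in
theorem setCost_nonneg (S : Finset ι) : 0 ≤ I.setCost S :=
  Finset.sum_nonneg fun i _ => I.cost_nonneg i

omit [DecidableEq ι] in
theorem f_le_Q (D : Finset U) : (I.f D : ℝ) ≤ I.Q :=
  Nat.cast_le.2 (I.monotone_f (Finset.subset_univ D))

/-- If `A` always covers the residual function over the base set `D`, then probing a suitable set
of items, at thrice the expected cost of `A`, covers a quarter of it in expectation. -/
theorem exists_set_quarter (A : AdaptiveSolution ι U) (w : ι → PMF U) (D : Finset U)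
    (hA : ∀ ω, (∀ i, ω i ∈ (w i).support) → I.f (D ∪ (A.probed ω).image ω) = I.Q) :
    ∃ S : Finset ι, I.setCost S ≤ 3 * lawExpect w (fun ω => I.setCost (A.probed ω)) ∧
      lawExpect w (fun ω => (I.Q : ℝ) - I.f (D ∪ S.image ω)) ≤ 3 / 4 * ((I.Q : ℝ) - I.f D) := by
  set a := lawExpect w (fun ω => I.setCost (A.probed ω)) with ha
  have ha0 : 0 ≤ a := by
    rw [← lawExpect_const w 0]
    exact lawExpect_mono fun ω _ => I.setCost_nonneg _
  set q : ℝ := (I.Q : ℝ) - I.f D with hq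
  have hq0 : 0 ≤ q := sub_nonneg.2 (I.f_le_Q D)
  let F : Finset ι → ℝ := fun S => lawExpect w fun ω => (I.f (D ∪ S.image ω) : ℝ)
  have hF : ∀ S, lawExpect w (fun ω => (I.Q : ℝ) - I.f (D ∪ S.image ω)) = I.Q - F S := fun S => by
    rw [lawExpect_sub, lawExpect_const]
  have hFQ : ∀ S, F S ≤ I.Q := fun S => by
    rw [← lawExpect_const w I.Q]
    exact lawExpect_mono fun ω _ => I.f_le_Q _
  have hgap : (I.Q : ℝ) + I.f D ≤ 2 * lawExpect w fun ω' => F (A.probed ω') := by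
    have := adaptive_le_two_mul_decoupled (g := fun X => (I.f X : ℝ))
      (fun X Y h => Nat.cast_le.2 (I.monotone_f h))
      (fun X Y => by exact_mod_cast I.submodular_f X Y) A ∅ w w D fun _ _ => rfl
    simp only [Finset.sdiff_empty] at this
    rwa [lawExpect_congr (h := fun _ => (I.Q : ℝ)) fun ω hω => by rw [hA ω hω],
      lawExpect_const] at this
  simp only [hF]
  rcases hq0.eq_or_lt with hq0 | hq0
  · refine ⟨∅, by simpa [setCost] using ha0, ?_⟩
    have : F ∅ = I.f D := by simp [F, lawExpect_const]
    rw [this]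
    linarith
  -- If `a = 0`, the weighted average below is useless, but almost every path is free; a free path
  -- of at least average value works.
  rcases ha0.eq_or_lt with ha0 | ha0
  · have h : lawExpect w (fun ω' => F (A.probed ω')) ≤
        lawExpect w fun ω' => if I.setCost (A.probed ω') ≤ 0 then F (A.probed ω') else 0 := by
      have hz : ∀ ω, (∏ i, (w i (ω i)).toReal) * I.setCost (A.probed ω) = 0 := by
        intro ω
        refine (Finset.sum_eq_zero_iff_of_nonneg fun ω _ => ?_).1 ha0.symm ω (Finset.mem_univ ω)
        exact mul_nonneg (Finset.prod_nonneg fun i _ => ENNReal.toReal_nonneg) (I.setCost_nonneg _)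
      refine Finset.sum_le_sum fun ω _ => ?_
      rcases mul_eq_zero.1 (hz ω) with h | h
      · simp [h]
      · simp [h]
    obtain ⟨ω, -, hω⟩ := exists_le_of_le_lawExpect h
    have hfD : (0 : ℝ) ≤ I.f D := Nat.cast_nonneg _
    split_ifs at hω with hc
    · exact ⟨A.probed ω, by linarith, by linarith⟩
    · linarith
  · have h : 2 * a * (I.Q + I.f D) - q * a ≤
        lawExpect w fun ω' => 4 * a * F (A.probed ω') - q * I.setCost (A.probed ω') := by
      rw [lawExpect_sub, lawExpect_const_mul, lawExpect_const_mul, ← ha]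
      nlinarith
    obtain ⟨ω, -, hω⟩ := exists_le_of_le_lawExpect h
    refine ⟨A.probed ω, ?_, ?_⟩
    · refine le_of_mul_le_mul_left ?_ hq0
      nlinarith [mul_le_mul_of_nonneg_left (hFQ (A.probed ω)) ha0.le]
    · refine le_of_mul_le_mul_left ?_ ha0
      nlinarith [mul_nonneg hq0.le (I.setCost_nonneg (A.probed ω))]

/-- `r` rounds, each at thrice the expected cost of the always covering adaptive solution `A`,
reduce the expected residual value by the factor `(3 / 4) ^ r`. -/
theorem exists_setSolution (A : AdaptiveSolution ι U) (r : ℕ) :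
    ∀ (w : ι → PMF U) (D : Finset U), ∃ B : SetSolution ι U r,
      (∀ ω, (∀ i, ω i ∈ (w i).support) → I.f (D ∪ (A.probed ω).image ω) = I.Q) →
      lawExpect w (fun ω => I.pathCost B ω) ≤
        3 * r * lawExpect w (fun ω => I.setCost (A.probed ω)) ∧
      lawExpect w (fun ω => (I.Q : ℝ) - I.f (D ∪ (B.probed ω).image ω)) ≤
        (3 / 4) ^ r * ((I.Q : ℝ) - I.f D) := by
  induction r with
  | zero =>
    intro w D
    exact ⟨.done, fun _ => by simp [pathCost, SetSolution.probed, lawExpect_const]⟩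
  | succ r ih =>
    intro w D
    by_cases hA : ∀ ω, (∀ i, ω i ∈ (w i).support) → I.f (D ∪ (A.probed ω).image ω) = I.Q
    swap
    · obtain ⟨B, -⟩ := ih w D
      exact ⟨.round ∅ fun _ => B, fun h => absurd h hA⟩
    obtain ⟨S, hS, hSF⟩ := I.exists_set_quarter A w D hA
    let law : (S → U) → ι → PMF U := fun ρ i => if h : i ∈ S then PMF.pure (ρ ⟨i, h⟩) else w i
    have hlaw : ∀ τ : ι → U, law (fun i => τ i) = condLaw w S τ := by
      intro τ
      funext i
      simp only [law, condLaw]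
      split_ifs <;> rfl
    -- The covering hypothesis stands inside the existential so that a continuation can be chosen
    -- for every `ρ`, including outcomes of probability zero.
    choose B hB using fun ρ : S → U => ih (law ρ) (D ∪ Finset.univ.image ρ)
    have himage : ∀ τ : ι → U, Finset.univ.image (fun i : S => τ i) = S.image τ := by
      intro τ
      ext x
      simp
    have hcond : ∀ {τ ω : ι → U}, (∀ i, τ i ∈ (w i).support) →
        (∀ i, ω i ∈ (condLaw w S τ i).support) →
        (∀ i, ω i ∈ (w i).support) ∧ ∀ i ∈ S, ω i = τ i := by
      intro τ ω hτ hω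
      have hS : ∀ i ∈ S, ω i = τ i := fun i hi => by simpa [condLaw, hi] using hω i
      refine ⟨fun i => ?_, hS⟩
      by_cases hi : i ∈ S
      · rw [hS i hi]
        exact hτ i
      · simpa only [condLaw, hi, if_false] using hω i
    have hB' : ∀ τ : ι → U, (∀ i, τ i ∈ (w i).support) → _ := fun τ hτ =>
      hB (fun i => τ i) fun ω hω => by
        rw [hlaw] at hω
        obtain ⟨h1, h2⟩ := hcond hτ hω
        refine le_antisymm (I.monotone_f (Finset.subset_univ _)) ?_
        rw [← hA ω h1]
        exact I.monotone_f (Finset.union_subset_union_left Finset.subset_union_left)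
    refine ⟨.round S B, fun _ => ⟨?_, ?_⟩⟩
    · have h1 : lawExpect w (fun ω => I.pathCost (.round S B) ω) ≤
          lawExpect w fun τ => I.setCost S +
            3 * r * lawExpect (condLaw w S τ) fun ω => I.setCost (A.probed ω) := by
        rw [← lawExpect_condLaw w S]
        refine lawExpect_mono fun τ hτ => ?_
        rw [lawExpect_congr (h := fun ω => I.setCost S + I.pathCost (B fun i => τ i) ω),
          lawExpect_add, lawExpect_const]
        · have := (hB' τ hτ).1
          rw [hlaw] at this
          linarith
        · intro ω hω
          have : (fun i : S => ω i) = fun i : S => τ i :=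
            funext fun i => (hcond hτ hω).2 i i.2
          rw [pathCost, this]
      rw [lawExpect_add, lawExpect_const, lawExpect_const_mul, lawExpect_condLaw] at h1
      push_cast
      linarith
    · have h1 : lawExpect w (fun ω =>
          (I.Q : ℝ) - I.f (D ∪ ((SetSolution.round S B).probed ω).image ω)) ≤
          lawExpect w fun τ => (3 / 4) ^ r * ((I.Q : ℝ) - I.f (D ∪ S.image τ)) := by
        rw [← lawExpect_condLaw w S]
        refine lawExpect_mono fun τ hτ => ?_
        have := (hB' τ hτ).2
        rw [hlaw, himage] at this
        refine le_trans (lawExpect_congr fun ω hω => ?_).le this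
        have h2 : (fun i : S => ω i) = fun i : S => τ i :=
          funext fun i => (hcond hτ hω).2 i i.2
        have h3 : S.image ω = S.image τ := by rw [← himage, ← himage, h2]
        rw [SetSolution.probed, h2, Finset.image_union, h3, Finset.union_assoc]
      rw [lawExpect_const_mul] at h1
      refine h1.trans ((mul_le_mul_of_nonneg_left hSF (by positivity)).trans_eq ?_)
      ring

/-- The infimum that defines `opt` is attained. -/
theorem exists_adaptiveCost_eq_opt :
    ∃ A : AdaptiveSolution ι U, I.AlwaysCovers A ∧ I.adaptiveCost A = I.opt := by
  have hfin : {c | ∃ A : AdaptiveSolution ι U,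
      I.AlwaysCovers A ∧ I.adaptiveCost A = c}.Finite := by
    -- The cost depends only on the map from realizations to probed sets, and there are finitely
    -- many such maps.
    refine (Set.finite_range fun p : (ι → U) → Finset ι =>
      I.expect fun ω => I.setCost (p ω)).subset ?_
    rintro _ ⟨A, -, rfl⟩
    exact ⟨A.probed, rfl⟩
  exact I.opt_set_nonempty_bddBelow.1.csInf_mem hfin

/-- Markov's inequality at threshold one: an uncovered realization has integer residual at least
one. -/
theorem exists_setSolution_of_opt (r : ℕ) : ∃ B : SetSolution ι U r,
    I.setBasedCost B ≤ 3 * r * I.opt ∧ 1 - (3 / 4 : ℝ) ^ r * I.Q ≤ I.coverProb B := by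
  obtain ⟨A, hA, hopt⟩ := I.exists_adaptiveCost_eq_opt
  obtain ⟨B, hB⟩ := I.exists_setSolution A r I.law ∅
  simp only [Finset.empty_union] at hB
  obtain ⟨h1, h2⟩ := hB hA
  refine ⟨B, by rw [← hopt]; exact h1, ?_⟩
  have h3 : lawExpect I.law (fun ω => 1 - ((I.Q : ℝ) - I.f ((B.probed ω).image ω))) ≤
      I.coverProb B := by
    refine lawExpect_mono fun ω _ => ?_
    have hle : I.f ((B.probed ω).image ω) ≤ I.Q := I.monotone_f (Finset.subset_univ _)
    split_ifs with h
    · have : (I.f ((B.probed ω).image ω) : ℝ) ≤ I.Q := I.f_le_Q _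
      linarith
    · have : (I.f ((B.probed ω).image ω) : ℝ) + 1 ≤ I.Q := by
        exact_mod_cast Nat.lt_of_le_of_ne hle h
      linarith
  rw [lawExpect_sub, lawExpect_const] at h3
  have h4 : (3 / 4 : ℝ) ^ r * ((I.Q : ℝ) - I.f ∅) ≤ (3 / 4 : ℝ) ^ r * I.Q :=
    mul_le_mul_of_nonneg_left (sub_le_self _ (Nat.cast_nonneg _)) (by positivity)
  linarith

end SSCInstance

end StochSubmodCover

/-! ### The number of rounds -/

theorem mainTheorem9 (κ : ℝ) (hκ : 0 < κ) :
    ∃ C : ℝ, 0 < C ∧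
      ∀ (ι U : Type*) [Fintype ι] [DecidableEq ι] [Fintype U] [DecidableEq U]
        (I : StochSubmodCover.SSCInstance ι U),
        ∃ (r : ℕ) (B : StochSubmodCover.SetSolution ι U r),
          (r : ℝ) ≤ C * Real.log (I.Q + 1) ∧
          I.setBasedCost B ≤ C * Real.log (I.Q + 1) * I.opt ∧
          1 - ((I.Q : ℝ) + 1) ^ (-κ) ≤ I.coverProb B := by
  have h43 : 0 < Real.log (4 / 3) := Real.log_pos (by norm_num)
  have h2 : 0 < Real.log 2 := Real.log_pos (by norm_num)
  -- The second summand absorbs the rounding of `r`: if `Q ≥ 1` then `log (Q + 1) ≥ log 2`, and if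
  -- `Q = 0` then `r = 0`.
  set K : ℝ := (κ + 1) / Real.log (4 / 3) + 1 / Real.log 2 with hK
  have hK0 : 0 < K := by positivity
  refine ⟨3 * K, by positivity, fun ι U _ _ _ _ I => ?_⟩
  set L := Real.log ((I.Q : ℝ) + 1) with hL
  have hQ0 : (0 : ℝ) ≤ I.Q := Nat.cast_nonneg _
  have hL0 : 0 ≤ L := Real.log_nonneg (by linarith)
  set r := ⌈(κ + 1) / Real.log (4 / 3) * L⌉₊ with hr
  have hrK : (r : ℝ) ≤ K * L := by
    rcases Nat.eq_zero_or_pos I.Q with h | h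
    · have : L = 0 := by simp [hL, h]
      simp [hr, this]
    · have h1 : Real.log 2 ≤ L :=
        Real.log_le_log (by norm_num) (by linarith [Nat.one_le_cast (α := ℝ).2 h])
      have h3 : 1 ≤ 1 / Real.log 2 * L := by
        rw [one_div_mul_eq_div]
        exact (one_le_div h2).2 h1
      have h4 := Nat.ceil_lt_add_one
        (show 0 ≤ (κ + 1) / Real.log (4 / 3) * L by positivity)
      rw [hK, add_mul]
      linarith
  have hopt : 0 ≤ I.opt := by
    obtain ⟨A, -, hA⟩ := I.exists_adaptiveCost_eq_opt
    rw [← hA]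
    exact Finset.sum_nonneg fun ω _ => mul_nonneg
      (Finset.prod_nonneg fun i _ => ENNReal.toReal_nonneg) (I.setCost_nonneg _)
  obtain ⟨B, hcost, hcover⟩ := I.exists_setSolution_of_opt r
  refine ⟨r, B, by nlinarith, hcost.trans ?_, le_trans (sub_le_sub_left ?_ 1) hcover⟩
  · exact mul_le_mul_of_nonneg_right (by linarith) hopt
  · have hpos : (0 : ℝ) < (I.Q : ℝ) + 1 := by linarith
    -- The exponent `κ + 1` rather than `κ` pays for the factor `Q` in the failure bound.
    have h1 : (3 / 4 : ℝ) ^ r ≤ ((I.Q : ℝ) + 1) ^ (-(κ + 1)) := by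
      rw [← Real.rpow_natCast, Real.rpow_def_of_pos (by norm_num), Real.rpow_def_of_pos hpos,
        Real.exp_le_exp, ← hL, show (3 / 4 : ℝ) = (4 / 3)⁻¹ by norm_num, Real.log_inv]
      have h3 : (κ + 1) / Real.log (4 / 3) * L ≤ r := Nat.le_ceil _
      rw [div_mul_eq_mul_div, div_le_iff₀ h43] at h3
      linarith
    calc (3 / 4 : ℝ) ^ r * I.Q ≤ ((I.Q : ℝ) + 1) ^ (-(κ + 1)) * ((I.Q : ℝ) + 1) :=
          mul_le_mul h1 (by linarith) hQ0 (by positivity)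
      _ = ((I.Q : ℝ) + 1) ^ (-κ) := by
          rw [← Real.rpow_add_one hpos.ne']
          congr 1
          ring
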